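/- Let $\mathbb X$ and $\mathbb Y$ be sets, let $\varepsilon_0\in\mathbb R$, and let $\mathcal R$ be an $\varepsilon_0$-LDP local randomizer with discrete output laws: for each $x\in\mathbb X$, $\mathcal R(x)$ is a random element of $\mathbb Y$ with a discrete distribution, and $\Pr[\mathcal R(x)\in T]\le e^{\varepsilon_0}\Pr[\mathcal R(x')\in T]$ for all $x,x'\in\mathbb X$ and all $T\subseteq\mathbb Y$. For $n\ge 1$ let $\boldsymbol X=(X_1,\dots,X_n)$ be a discrete random vector in $\mathbb X^n$ with an arbitrary joint law $P_{\boldsymbol X}$ (no independence is assumed). Given $\boldsymbol X$, let the messages $Y_i=\mathcal R(X_i)$ be drawn independently, let $\sigma$ be a uniformly random permutation of $\{1,\dots,n\}$ independent of $(X_i,Y_i)_i$, and let $\boldsymbol Z=(Y_{\sigma(i)})_{i=1}^n$ and $\boldsymbol X_{-1}=(X_2,\dots,X_n)$. Write $I(A;B)=\sum_{a,b}p_{A,B}(a,b)\log\frac{p_{A,B}(a,b)}{p_A(a)p_B(b)}$ (natural logarithm), let $I(A;B\mid V=v)$ be the same quantity under the law conditioned on $V=v$, and let $I(A;B\mid V)=\sum_v\Pr[V=v]\,I(A;B\mid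 V=v)$. Then there is a constant $C$ that depends only on $\mathcal R$ and $\varepsilon_0$ such that for all $n\ge 1$ and all $P_{\boldsymbol X}$ the series below converge absolutely and: 1. for every $\boldsymbol x_{-1}\in\mathbb X^{n-1}$ with $\Pr[\boldsymbol X_{-1}=\boldsymbol x_{-1}]>0$, $$I(X_1;\boldsymbol Z\mid \boldsymbol X_{-1}=\boldsymbol x_{-1})\le \frac{e^{\varepsilon_0}-1}{2n}+C\,n^{-3/2};$$ 2. $$I(X_1;\boldsymbol Z\mid \boldsymbol X_{-1})\le \frac{e^{\varepsilon_0}-1}{2n}+C\,n^{-3/2};$$ 3. if $X_1$ is independent of $\boldsymbol X_{-1}$, then $$I(X_1;\boldsymbol Z)\le \frac{e^{\varepsilon_0}-1}{2n}+C\,n^{-3/2}.$$ -/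

import Mathlib

namespace ShuffleDP

noncomputable section

/-! ## Local randomizers and local differential privacy -/

/-- Two discrete distributions are `(ε, δ)`-indistinguishable (one direction; the definition of
local differential privacy quantifies over both orders). -/
def Indistinguishable {α : Type*} (ε δ : ℝ) (p q : PMF α) : Prop :=
  ∀ T : Set α, (p.toOuterMeasure T).toReal ≤ Real.exp ε * (q.toOuterMeasure T).toReal + δ

/-- Local `(ε, δ)`-differential privacy of a randomizer `R`; `R x` is the law of `R(x)`. -/
def IsLocallyDP {X Y : Type*} (R : X → PMF Y) (ε δ : ℝ) : Prop :=
  ∀ x x' : X, Indistinguishable ε δ (R x) (R x')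

/-- `R` is an `ε₀`-LDP local randomizer. -/
def IsLDP {X Y : Type*} (R : X → PMF Y) (ε₀ : ℝ) : Prop :=
  IsLocallyDP R ε₀ 0

/-! ## Discrete random variables and mutual information

A random variable is a function on a type `Ω` that carries a discrete law `p : PMF Ω`. -/

/-- The law `p` conditioned on the event `V = c`, which has positive probability. -/
def condLaw {Ω γ : Type*} (p : PMF Ω) (V : Ω → γ) (c : γ) (hc : c ∈ (p.map V).support) : PMF Ω :=
  p.filter {ω | V ω = c} (by
    obtain ⟨ω, hω, rfl⟩ := (PMF.mem_support_map_iff V p c).1 hc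
    exact ⟨ω, rfl, hω⟩)

/-- Independence of two discrete random variables. -/
def Independent {Ω α β : Type*} (p : PMF Ω) (A : Ω → α) (B : Ω → β) : Prop :=
  ∀ a b, p.map (fun ω => (A ω, B ω)) (a, b) = p.map A a * p.map B b

/-- The `(a, b)` term `p_{A,B}(a,b) log (p_{A,B}(a,b) / (p_A(a) p_B(b)))` of mutual information
(natural logarithm; the term is `0` where `p_{A,B}(a,b) = 0`). -/
def mutualInfoTerm {Ω α β : Type*} (p : PMF Ω) (A : Ω → α) (B : Ω → β) (ab : α × β) : ℝ :=
  (p.map (fun ω => (A ω, B ω)) ab).toReal *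
    Real.log ((p.map (fun ω => (A ω, B ω)) ab).toReal /
      ((p.map A ab.1).toReal * (p.map B ab.2).toReal))

/-- The series that defines the mutual information converges absolutely. -/
def FiniteMutualInfo {Ω α β : Type*} (p : PMF Ω) (A : Ω → α) (B : Ω → β) : Prop :=
  Summable (mutualInfoTerm p A B)

/-- The mutual information `I(A; B)` under the law `p`. -/
def mutualInfo {Ω α β : Type*} (p : PMF Ω) (A : Ω → α) (B : Ω → β) : ℝ :=
  ∑' ab : α × β, mutualInfoTerm p A B ab

open Classical in
/-- The `c` term `Pr[V = c] * I(A; B | V = c)` of conditional mutual information (`0` if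
`Pr[V = c] = 0`). -/
def condMutualInfoTerm {Ω α β γ : Type*} (p : PMF Ω) (A : Ω → α) (B : Ω → β) (V : Ω → γ)
    (c : γ) : ℝ :=
  if hc : c ∈ (p.map V).support then
    (p.map V c).toReal * mutualInfo (condLaw p V c hc) A B
  else 0

/-- All the series that define the conditional mutual information converge absolutely. -/
def FiniteCondMutualInfo {Ω α β γ : Type*} (p : PMF Ω) (A : Ω → α) (B : Ω → β) (V : Ω → γ) :
    Prop :=
  (∀ (c : γ) (hc : c ∈ (p.map V).support), FiniteMutualInfo (condLaw p V c hc) A B) ∧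
    Summable (condMutualInfoTerm p A B V)

/-- The conditional mutual information `I(A; B | V)`, the expectation over `V` of
`I(A; B | V = c)`. -/
def condMutualInfo {Ω α β γ : Type*} (p : PMF Ω) (A : Ω → α) (B : Ω → β) (V : Ω → γ) : ℝ :=
  ∑' c : γ, condMutualInfoTerm p A B V c

/-! ## The shuffle model -/

theorem tsum_prod_apply {Y : Type*} : ∀ (n : ℕ) (p : Fin n → PMF Y),
    ∑' y : Fin n → Y, ∏ i, p i (y i) = 1
  | 0, p => by simp
  | n + 1, p => by
    rw [← (Fin.consEquiv (fun _ : Fin (n + 1) => Y)).tsum_eq, ENNReal.tsum_prod']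
    simp [Fin.consEquiv, Fin.prod_univ_succ, ENNReal.tsum_mul_left,
      tsum_prod_apply n (fun i => p i.succ), PMF.tsum_coe]

/-- The law of independent messages `y_i ∼ p i`, `i = 1, …, n`. -/
def indepLaw {Y : Type*} {n : ℕ} (p : Fin n → PMF Y) : PMF (Fin n → Y) :=
  ⟨fun y => ∏ i, p i (y i), by
    rw [← tsum_prod_apply n p]
    exact ENNReal.summable.hasSum⟩

/-- A realization of the shuffle model with `n` users: the inputs `x`, the messages `y` and the
permutation `σ` used by the shuffler. -/
abbrev Outcome (X Y : Type*) (n : ℕ) : Type _ :=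
  (Fin n → X) × (Fin n → Y) × Equiv.Perm (Fin n)

/-- The joint law in the shuffle-DP setting: the database `x` has the (arbitrary) joint law `P`;
given `x`, the messages `y_i ∼ R(x_i)` are independent; and `σ` is a uniformly random permutation,
independent of `(x, y)`. -/
def shuffleLaw {X Y : Type*} {n : ℕ} (R : X → PMF Y) (P : PMF (Fin n → X)) :
    PMF (Outcome X Y n) :=
  P.bind fun x => (indepLaw fun i => R (x i)).bind fun y =>
    (PMF.uniformOfFintype (Equiv.Perm (Fin n))).map fun σ => (x, y, σ)

/-- The shuffled output `Z = (Y_{σ(i)})_i`. -/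
def shuffled {X Y : Type*} {n : ℕ} (ω : Outcome X Y n) : Fin n → Y :=
  fun i => ω.2.1 (ω.2.2 i)

/-- The input `X₁` of the first user, who has index `0`. -/
def firstInput {X Y : Type*} {m : ℕ} (ω : Outcome X Y (m + 1)) : X :=
  ω.1 0

/-- The inputs `X₋₁ = (X₂, …, Xₙ)` of the other users. -/
def otherInputs {X Y : Type*} {m : ℕ} (ω : Outcome X Y (m + 1)) : Fin m → X :=
  fun i => ω.1 i.succ

/-- The bound `(e^ε₀ - 1) / (2n) + C n^{-3/2}`. -/
def leakageBound (ε₀ C : ℝ) (n : ℕ) : ℝ :=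
  (Real.exp ε₀ - 1) / (2 * (n : ℝ)) + C * (n : ℝ) ^ (-(3 / 2) : ℝ)

end

end ShuffleDP

/-! By LDP the laws `R x` share a common part: `R x = γ ω + (1 - γ) ρ x`, where `γ` is the mass of
the pointwise infimum (`IsLDP.exists_blanket`), and the likelihood ratio `l` of `R a` to `ω` is at
most `exp ε₀ * γ`. Each other user thus sends a message from `ω` with probability `γ`, as recorded
by a flag. Take as reference the law in which the first message also comes from `ω`; for first input
`a` the true law has density `l (y 0)`.

The shuffled output only sees symmetric functions, and `y 0` is exchangeable with the flagged
messages, so this density may be replaced by the average of `l` over these `N` messages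
(`expect_flaggedAvg_mul`). The average fluctuates around 1 with variance `V / N`, where `V ≤ exp ε₀
* γ - 1`, and `u log u ≈ (u - 1) + (u - 1)² / 2` gives relative entropy about `V / (2N)`. Since
`E[1/N] ≤ 1 / (γ n)`, the leading term is at most `(exp ε₀ - 1) / (2n)`; fourth moments control the
error (`expect_flaggedAvg_mul_log_le`).

Mutual information is bounded by the worst relative entropy to a reference law
(`mutualInfo_le_of_density`). Both the conditioned and the independent case have `X₁` independent of
the other inputs, so `IsLDP.exists_mutualInfo_le` covers them together. -/

namespace ShuffleDP

/-! ## Expectations of bounded functions under discrete laws -/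

/-- A bounded real function. -/
def IsBdd {α : Type*} (h : α → ℝ) : Prop := ∃ B, ∀ a, |h a| ≤ B

/-- The expectation of `h` under the discrete law `p`. -/
noncomputable def expect {α : Type*} (p : PMF α) (h : α → ℝ) : ℝ := ∑' a, (p a).toReal * h a

section Expect

variable {α β γ : Type*} {p : PMF α} {f g h : α → ℝ}

theorem IsBdd.const (c : ℝ) : IsBdd fun _ : α => c := ⟨|c|, fun _ => le_rfl⟩

theorem IsBdd.add (hf : IsBdd f) (hg : IsBdd g) : IsBdd fun a => f a + g a := by
  obtain ⟨B, hB⟩ := hf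
  obtain ⟨C, hC⟩ := hg
  exact ⟨B + C, fun a => (abs_add_le _ _).trans (add_le_add (hB a) (hC a))⟩

theorem IsBdd.mul (hf : IsBdd f) (hg : IsBdd g) : IsBdd fun a => f a * g a := by
  obtain ⟨B, hB⟩ := hf
  obtain ⟨C, hC⟩ := hg
  refine ⟨B * C, fun a => ?_⟩
  rw [abs_mul]
  exact mul_le_mul (hB a) (hC a) (abs_nonneg _) ((abs_nonneg _).trans (hB a))

theorem IsBdd.const_mul (c : ℝ) (hf : IsBdd f) : IsBdd fun a => c * f a := (IsBdd.const c).mul hf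

theorem IsBdd.sub (hf : IsBdd f) (hg : IsBdd g) : IsBdd fun a => f a - g a := by
  simpa [sub_eq_add_neg] using hf.add (hg.const_mul (-1))

theorem IsBdd.pow (hf : IsBdd f) (k : ℕ) : IsBdd fun a => f a ^ k := by
  obtain ⟨B, hB⟩ := hf
  refine ⟨B ^ k, fun a => ?_⟩
  rw [abs_pow]
  exact pow_le_pow_left₀ (abs_nonneg _) (hB a) k

theorem IsBdd.sum {ι : Type*} (s : Finset ι) {F : ι → α → ℝ} (hF : ∀ i ∈ s, IsBdd (F i)) :
    IsBdd fun a => ∑ i ∈ s, F i a := by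
  classical
  induction s using Finset.induction_on with
  | empty => simpa using IsBdd.const (α := α) 0
  | insert i s hi ih =>
    simp only [Finset.sum_insert hi]
    exact (hF i (by simp)).add (ih fun j hj => hF j (by simp [hj]))

theorem IsBdd.comp {h : β → ℝ} (hh : IsBdd h) (u : α → β) : IsBdd fun a => h (u a) :=
  hh.imp fun _ hB a => hB (u a)

theorem IsBdd.of_finite [Finite α] (h : α → ℝ) : IsBdd h := by
  cases nonempty_fintype α
  exact ⟨∑ a, |h a|, fun a => Finset.single_le_sum (f := fun a => |h a|)
    (fun _ _ => abs_nonneg _) (Finset.mem_univ a)⟩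

theorem summable_toReal_pmf (p : PMF α) : Summable fun a => (p a).toReal :=
  ENNReal.summable_toReal (by simp [p.tsum_coe])

theorem tsum_toReal_pmf (p : PMF α) : ∑' a, (p a).toReal = 1 := by
  rw [← ENNReal.tsum_toReal_eq fun a => p.apply_ne_top a, p.tsum_coe, ENNReal.toReal_one]

theorem summable_expect (p : PMF α) (hh : IsBdd h) : Summable fun a => (p a).toReal * h a := by
  obtain ⟨B, hB⟩ := hh
  refine Summable.of_norm_bounded ((summable_toReal_pmf p).mul_right B) fun a => ?_
  rw [Real.norm_eq_abs, abs_mul, abs_of_nonneg ENNReal.toReal_nonneg]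
  exact mul_le_mul_of_nonneg_left (hB a) ENNReal.toReal_nonneg

theorem expect_const (p : PMF α) (c : ℝ) : expect p (fun _ => c) = c := by
  simp [expect, tsum_mul_right, tsum_toReal_pmf]

theorem expect_add (hf : IsBdd f) (hg : IsBdd g) :
    expect p (fun a => f a + g a) = expect p f + expect p g := by
  simp only [expect, mul_add]
  exact (summable_expect p hf).tsum_add (summable_expect p hg)

theorem expect_sub (hf : IsBdd f) (hg : IsBdd g) :
    expect p (fun a => f a - g a) = expect p f - expect p g := by
  simp only [expect, mul_sub]
  exact (summable_expect p hf).tsum_sub (summable_expect p hg)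

theorem expect_const_mul (c : ℝ) (h : α → ℝ) :
    expect p (fun a => c * h a) = c * expect p h := by
  simp only [expect, mul_left_comm _ c, tsum_mul_left]

theorem expect_sum {ι : Type*} (s : Finset ι) {F : ι → α → ℝ} (hF : ∀ i ∈ s, IsBdd (F i)) :
    expect p (fun a => ∑ i ∈ s, F i a) = ∑ i ∈ s, expect p (F i) := by
  simp only [expect, Finset.mul_sum]
  exact Summable.tsum_finsetSum fun i hi => summable_expect p (hF i hi)

theorem expect_mono_of_support (hf : IsBdd f) (hg : IsBdd g)
    (hfg : ∀ a, p a ≠ 0 → f a ≤ g a) : expect p f ≤ expect p g := by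
  refine (summable_expect p hf).tsum_le_tsum (fun a => ?_) (summable_expect p hg)
  by_cases ha : p a = 0
  · simp [ha]
  · exact mul_le_mul_of_nonneg_left (hfg a ha) ENNReal.toReal_nonneg

theorem expect_mono (hf : IsBdd f) (hg : IsBdd g) (hfg : ∀ a, f a ≤ g a) :
    expect p f ≤ expect p g := expect_mono_of_support hf hg fun a _ => hfg a

theorem expect_le_of_le (hf : IsBdd f) {c : ℝ} (hc : ∀ a, f a ≤ c) : expect p f ≤ c :=
  (expect_mono hf (IsBdd.const c) hc).trans_eq (expect_const p c)

theorem le_expect_of_le (hf : IsBdd f) {c : ℝ} (hc : ∀ a, c ≤ f a) : c ≤ expect p f :=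
  (expect_const p c).symm.trans_le (expect_mono (IsBdd.const c) hf hc)

theorem abs_expect_le {B : ℝ} (hB : ∀ a, |f a| ≤ B) : |expect p f| ≤ B :=
  abs_le.2 ⟨le_expect_of_le ⟨B, hB⟩ fun a => (abs_le.1 (hB a)).1,
    expect_le_of_le ⟨B, hB⟩ fun a => (abs_le.1 (hB a)).2⟩

theorem IsBdd.expect {q : β → PMF α} {h : β → α → ℝ} (hh : ∃ B, ∀ b a, |h b a| ≤ B) :
    IsBdd fun b => expect (q b) (h b) :=
  hh.imp fun _ hB b => abs_expect_le (hB b)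

theorem expect_bind (p : PMF α) (q : α → PMF β) {h : β → ℝ} (hh : IsBdd h) :
    expect (p.bind q) h = expect p fun a => expect (q a) h := by
  have hs : Summable fun ab : α × β => (p ab.1 * q ab.1 ab.2).toReal := by
    refine ENNReal.summable_toReal ?_
    rw [ENNReal.tsum_prod']
    simp [ENNReal.tsum_mul_left, PMF.tsum_coe]
  have hs' : Summable fun ab : α × β => (p ab.1 * q ab.1 ab.2).toReal * h ab.2 := by
    obtain ⟨B, hB⟩ := hh
    refine Summable.of_norm_bounded (hs.mul_right B) fun ab => ?_
    rw [Real.norm_eq_abs, abs_mul, abs_of_nonneg ENNReal.toReal_nonneg]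
    exact mul_le_mul_of_nonneg_left (hB _) ENNReal.toReal_nonneg
  have h1 : ∀ b, ((p.bind q) b).toReal * h b = ∑' a, (p a * q a b).toReal * h b := fun b => by
    rw [PMF.bind_apply, ENNReal.tsum_toReal_eq, tsum_mul_right]
    exact fun a => ENNReal.mul_ne_top (p.apply_ne_top a) ((q a).apply_ne_top b)
  simp only [expect, h1]
  rw [Summable.tsum_comm (f := fun a b => (p a * q a b).toReal * h b) hs']
  simp only [ENNReal.toReal_mul, mul_assoc, tsum_mul_left]

theorem expect_pure (a : α) (h : α → ℝ) : expect (PMF.pure a) h = h a := by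
  classical
  rw [expect, tsum_eq_single a]
  · simp
  · intro b hb
    simp [PMF.pure_apply, hb]

theorem expect_map (p : PMF α) (u : α → β) {h : β → ℝ} (hh : IsBdd h) :
    expect (p.map u) h = expect p fun a => h (u a) := by
  rw [PMF.map, expect_bind p _ hh]
  simp only [Function.comp_apply, expect_pure]

theorem expect_comm (p : PMF α) (q : PMF β) {F : α → β → ℝ} (hF : ∃ B, ∀ a b, |F a b| ≤ B) :
    expect p (fun a => expect q (F a)) = expect q fun b => expect p fun a => F a b := by
  have hF' : IsBdd fun ab : α × β => F ab.1 ab.2 := hF.imp fun _ hB ab => hB _ _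
  have h := congrArg (fun r => expect r fun ab : α × β => F ab.1 ab.2)
    (PMF.bind_comm p q fun a b => PMF.pure (a, b))
  simpa only [expect_bind _ _ hF', expect_pure] using h

/-- Change of measure with a bounded density. -/
theorem expect_of_density {q : PMF α} {l : α → ℝ} (hl : ∀ a, (q a).toReal = (p a).toReal * l a)
    (h : α → ℝ) : expect q h = expect p fun a => l a * h a := by
  simp only [expect, hl, mul_assoc]

end Expect

/-! ## A bound on mutual information -/

section MutualInfo

variable {Ω α β E : Type*}

theorem bind_map_mk_apply (π : PMF α) (K : α → PMF β) (a : α) (b : β) :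
    (π.bind fun a => (K a).map (Prod.mk a)) (a, b) = π a * K a b := by
  classical
  rw [PMF.bind_apply, tsum_eq_single a]
  · rw [PMF.map_apply, tsum_eq_single b]
    · simp
    · intro b' h'
      simp [Ne.symm h']
  · intro a' h'
    rw [PMF.map_apply]
    simp [Ne.symm h']

/-- This is `log t ≤ t - 1` at `t = L / u`. It makes the dependence on `L` linear, so that `L` can
later be averaged out. -/
theorem tangent_mul_log {u L : ℝ} (hu : 0 ≤ u) (hL : 0 < L) :
    u * Real.log L ≤ u * Real.log u - u + L := by
  rcases hu.eq_or_lt with rfl | hu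
  · simpa using hL.le
  · have h := Real.log_le_sub_one_of_pos (div_pos hL hu)
    rw [Real.log_div hL.ne' hu.ne'] at h
    have := mul_le_mul_of_nonneg_left h hu.le
    have h2 : u * (L / u - 1) = L - u := by field_simp
    linarith

theorem IsBdd.mul_log {f : α → ℝ} (hf0 : ∀ a, 0 ≤ f a) (hf : IsBdd f) :
    IsBdd fun a => f a * Real.log (f a) := by
  obtain ⟨B, hB⟩ := hf
  refine ⟨B * B + 1, fun a => ?_⟩
  have h0 := hf0 a
  have h1 := hB a
  rw [abs_of_nonneg h0] at h1
  have h2 := tangent_mul_log h0 one_pos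
  have h3 := mul_le_mul_of_nonneg_left (Real.log_le_self h0) h0
  have h4 := mul_self_le_mul_self h0 h1
  rw [Real.log_one, mul_zero] at h2
  rw [abs_le]
  constructor
  · nlinarith
  · linarith

/-- Mutual information of a pair `(a, b)` with `a ∼ π` and `b ∼ K a`, when the kernel `K` is
`ε`-indistinguishable and `K a` is the image under `Z` of the law with density `g a` with respect
to a common law `M`. -/
theorem mutualInfo_le_of_density {p : PMF Ω} {A : Ω → α} {B : Ω → β} {π : PMF α} {K : α → PMF β}
    (hJ : p.map (fun ω => (A ω, B ω)) = π.bind fun a => (K a).map (Prod.mk a))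
    {ε : ℝ} (hε : 0 ≤ ε)
    (hK : ∀ a a' b, (K a b).toReal ≤ Real.exp ε * (K a' b).toReal)
    (M : PMF E) (Z : E → β) (g : α → E → ℝ) (hg0 : ∀ a e, 0 ≤ g a e)
    (hgB : ∃ B, ∀ a e, |g a e| ≤ B)
    (hKg : ∀ a (h : β → ℝ), IsBdd h → expect (K a) h = expect M fun e => g a e * h (Z e))
    {D : ℝ} (hD : ∀ a, expect M (fun e => g a e * Real.log (g a e)) ≤ D) :
    FiniteMutualInfo p A B ∧ |mutualInfo p A B| ≤ ε ∧ mutualInfo p A B ≤ D := by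
  classical
  set q : PMF β := π.bind K with hq
  -- The value 1 on null points of `q` keeps both the bounds on `log L` and the identity `hL1` valid
  -- for every `b`.
  set L : α → β → ℝ := fun a b => if q b = 0 then 1 else (K a b).toReal / (q b).toReal with hL
  have hKb : ∀ b, IsBdd fun a => (K a b).toReal := fun b =>
    ⟨1, fun a => by
      rw [abs_of_nonneg ENNReal.toReal_nonneg]
      exact ENNReal.toReal_le_of_le_ofReal zero_le_one (by simpa using (K a).coe_le_one b)⟩
  have hqe : ∀ b, (q b).toReal = expect π fun a => (K a b).toReal := fun b => by
    rw [hq, PMF.bind_apply, ENNReal.tsum_toReal_eq]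
    · simp [expect]
    · exact fun a => ENNReal.mul_ne_top (π.apply_ne_top a) ((K a).apply_ne_top b)
  have hqpos : ∀ b, q b ≠ 0 → 0 < (q b).toReal := fun b hb =>
    ENNReal.toReal_pos hb (q.apply_ne_top b)
  have hexp1 : 1 ≤ Real.exp ε := Real.one_le_exp hε
  have hLle : ∀ a b, L a b ≤ Real.exp ε := fun a b => by
    simp only [hL]
    split_ifs with hb
    · exact hexp1
    · rw [div_le_iff₀ (hqpos b hb), hqe, ← expect_const_mul]
      exact le_expect_of_le ((hKb b).const_mul _) fun a' => hK a a' b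
  have hLge : ∀ a b, Real.exp (-ε) ≤ L a b := fun a b => by
    simp only [hL]
    split_ifs with hb
    · exact Real.exp_le_one_iff.2 (by linarith)
    · rw [le_div_iff₀ (hqpos b hb), Real.exp_neg, inv_mul_le_iff₀ (Real.exp_pos ε), hqe]
      exact expect_le_of_le (hKb b) fun a' => hK a' a b
  have hLpos : ∀ a b, 0 < L a b := fun a b => (Real.exp_pos _).trans_le (hLge a b)
  have hlog : ∀ a b, |Real.log (L a b)| ≤ ε := fun a b => by
    rw [abs_le, Real.le_log_iff_exp_le (hLpos a b), Real.log_le_iff_le_exp (hLpos a b)]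
    exact ⟨hLge a b, hLle a b⟩
  have hLB : ∀ a b, |L a b| ≤ Real.exp ε := fun a b => by
    rw [abs_of_pos (hLpos a b)]
    exact hLle a b
  have hL1 : ∀ b, expect π (fun a => L a b) = 1 := fun b => by
    by_cases hb : q b = 0
    · simp [hL, hb, expect_const]
    · simp only [hL, hb, if_false, div_eq_inv_mul]
      rw [expect_const_mul, ← hqe, inv_mul_cancel₀ (hqpos b hb).ne']
  have hA : p.map A = π := by
    have h := congrArg (PMF.map Prod.fst) hJ
    rw [PMF.map_comp, PMF.map_bind] at h
    simp only [PMF.map_comp] at h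
    refine h.trans ?_
    rw [show (fun a => PMF.map (Prod.fst ∘ Prod.mk a) (K a)) = PMF.pure from
      funext fun a => (K a).map_const a, PMF.bind_pure]
  have hB : p.map B = q := by
    have h := congrArg (PMF.map Prod.snd) hJ
    rw [PMF.map_comp, PMF.map_bind] at h
    simp only [PMF.map_comp] at h
    refine h.trans ?_
    rw [hq, show (fun a => PMF.map (Prod.snd ∘ Prod.mk a) (K a)) = K from
      funext fun a => (K a).map_id]
  set J : PMF (α × β) := π.bind fun a => (K a).map (Prod.mk a) with hJdef
  have hterm : mutualInfoTerm p A B = fun ab => (J ab).toReal * Real.log (L ab.1 ab.2) := by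
    funext ⟨a, b⟩
    rw [mutualInfoTerm, hJ, hA, hB]
    by_cases h0 : J (a, b) = 0
    · simp [h0]
    · rw [hJdef, bind_map_mk_apply] at h0 ⊢
      have hπ := left_ne_zero_of_mul h0
      have hKab := right_ne_zero_of_mul h0
      have hqb : q b ≠ 0 := by
        rw [hq, ← PMF.mem_support_iff, PMF.mem_support_bind_iff]
        exact ⟨a, hπ, hKab⟩
      have hπ' : (π a).toReal ≠ 0 := (ENNReal.toReal_pos hπ (π.apply_ne_top a)).ne'
      simp only [hL, hqb, if_false, ENNReal.toReal_mul, mul_div_mul_left _ _ hπ']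
  have hbdd : IsBdd fun ab : α × β => Real.log (L ab.1 ab.2) := ⟨ε, fun ab => hlog _ _⟩
  have hI : mutualInfo p A B = expect J fun ab => Real.log (L ab.1 ab.2) := by
    rw [mutualInfo, hterm, expect]
  refine ⟨?_, ?_, ?_⟩
  · rw [FiniteMutualInfo, hterm]
    exact summable_expect J hbdd
  · rw [hI]
    exact abs_expect_le fun ab => hlog _ _
  · obtain ⟨C, hC⟩ := hgB
    have hgb : ∀ a, IsBdd (g a) := fun a => ⟨C, hC a⟩
    have hLz : ∀ a, IsBdd fun e => L a (Z e) := fun a => ⟨Real.exp ε, fun e => hLB _ _⟩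
    have hg1 : ∀ a, expect M (g a) = 1 := fun a => by
      have h := hKg a (fun _ => 1) (IsBdd.const 1)
      simpa [expect_const] using h.symm
    have hLM : IsBdd fun a => expect M fun e => L a (Z e) :=
      IsBdd.expect (q := fun _ => M) ⟨Real.exp ε, fun a e => hLB _ _⟩
    -- The variational form of relative entropy: the tangent inequality with `u = g a e`, integrated
    -- against `M`.
    have step : ∀ a, expect (K a) (fun b => Real.log (L a b)) ≤
        D - 1 + expect M fun e => L a (Z e) := fun a => by
      have hgl := IsBdd.mul_log (hg0 a) (hgb a)
      rw [hKg a _ ⟨ε, hlog a⟩]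
      calc expect M (fun e => g a e * Real.log (L a (Z e)))
          ≤ expect M fun e => g a e * Real.log (g a e) - g a e + L a (Z e) :=
            expect_mono ((hgb a).mul ⟨ε, fun e => hlog a (Z e)⟩)
              ((hgl.sub (hgb a)).add (hLz a)) fun e => tangent_mul_log (hg0 a e) (hLpos _ _)
        _ = expect M (fun e => g a e * Real.log (g a e)) - 1 + expect M fun e => L a (Z e) := by
            rw [expect_add (hgl.sub (hgb a)) (hLz a), expect_sub hgl (hgb a), hg1]
        _ ≤ _ := by linarith [hD a]
    rw [hI, hJdef, expect_bind _ _ hbdd]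
    have e1 : ∀ a, expect ((K a).map (Prod.mk a)) (fun ab : α × β => Real.log (L ab.1 ab.2)) =
        expect (K a) fun b => Real.log (L a b) := fun a => expect_map _ _ hbdd
    simp only [e1]
    calc expect π (fun a => expect (K a) fun b => Real.log (L a b))
        ≤ expect π fun a => D - 1 + expect M fun e => L a (Z e) :=
          expect_mono (IsBdd.expect ⟨ε, hlog⟩) ((IsBdd.const _).add hLM) step
      -- The inner mean is 1 at every point, so `M` need not be related to the output law `q`.
      _ = D - 1 + expect M fun e => expect π fun a => L a (Z e) := by
          rw [expect_add (IsBdd.const _) hLM, expect_const,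
            expect_comm _ _ ⟨Real.exp ε, fun a e => hLB _ _⟩]
      _ = D := by simp only [hL1, expect_const, sub_add_cancel]

end MutualInfo

/-! ## Expectations under product laws -/

section IndepLaw

variable {Y : Type*} {n m : ℕ}

theorem indepLaw_apply (p : Fin n → PMF Y) (y : Fin n → Y) : indepLaw p y = ∏ i, p i (y i) := rfl

theorem expect_indepLaw_succ (p : Fin (n + 1) → PMF Y) {h : (Fin (n + 1) → Y) → ℝ}
    (hh : IsBdd h) :
    expect (indepLaw p) h =
      expect (p 0) fun a => expect (indepLaw fun i => p i.succ) fun y => h (Fin.cons a y) := by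
  have hs := summable_expect (indepLaw p) hh
  rw [← (Fin.consEquiv fun _ : Fin (n + 1) => Y).summable_iff] at hs
  simp only [expect]
  rw [← (Fin.consEquiv fun _ : Fin (n + 1) => Y).tsum_eq]
  refine (Summable.tsum_prod hs).trans ?_
  simp [indepLaw_apply, Fin.consEquiv, Fin.prod_univ_succ, mul_assoc, tsum_mul_left]

theorem expect_indepLaw_comp_perm (p : Fin n → PMF Y) (τ : Equiv.Perm (Fin n))
    (hτ : ∀ i, p (τ i) = p i) (h : (Fin n → Y) → ℝ) :
    expect (indepLaw p) (fun y => h fun i => y (τ i)) = expect (indepLaw p) h := by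
  symm
  rw [expect, expect, ← (τ.symm.arrowCongr (Equiv.refl Y)).tsum_eq]
  refine tsum_congr fun y => ?_
  have : indepLaw p ((τ.symm.arrowCongr (Equiv.refl Y)) y) = indepLaw p y := by
    simp only [indepLaw_apply]
    rw [← Equiv.prod_comp τ (fun i => p i (y i))]
    exact Finset.prod_congr rfl fun i _ => by simp [hτ]
  rw [this]
  rfl

/-- Independent messages from mixtures: the mixture components are independent. -/
theorem indepLaw_cons_bind (ω : PMF Y) (β : PMF Bool) (k : Fin m → Bool → PMF Y) :
    indepLaw (Fin.cons ω fun i => β.bind (k i)) =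
      (indepLaw fun _ : Fin m => β).bind fun c => indepLaw (Fin.cons ω fun i => k i (c i)) := by
  refine PMF.ext fun y => ?_
  simp only [PMF.bind_apply, indepLaw_apply, Fin.prod_univ_succ, Fin.cons_zero, Fin.cons_succ,
    tsum_fintype]
  rw [Finset.prod_univ_sum, Finset.mul_sum, Fintype.piFinset_univ]
  refine Finset.sum_congr rfl fun c _ => ?_
  rw [Finset.prod_mul_distrib]
  ring

/-- Cross terms vanish by independence and centring. The first moment is carried through the
induction because the cross term of the square needs it. -/
theorem expect_sum_sq_indepLaw {b : ℝ} : ∀ (n : ℕ) (p : Fin n → PMF Y) (ξ : Fin n → Y → ℝ),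
    (∀ i y, |ξ i y| ≤ b) → (∀ i, expect (p i) (ξ i) = 0) →
    expect (indepLaw p) (fun y => ∑ i, ξ i (y i)) = 0 ∧
    expect (indepLaw p) (fun y => (∑ i, ξ i (y i)) ^ 2) = ∑ i, expect (p i) fun y => ξ i y ^ 2
  | 0, p, ξ, _, _ => by simp [expect_const]
  | n + 1, p, ξ, hb, h0 => by
    obtain ⟨ih1, ih2⟩ := expect_sum_sq_indepLaw n (fun i => p i.succ) (fun i => ξ i.succ)
      (fun i => hb i.succ) fun i => h0 i.succ
    have hξ : ∀ i, IsBdd (ξ i) := fun i => ⟨b, hb i⟩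
    have hS : IsBdd fun y : Fin n → Y => ∑ i, ξ i.succ (y i) :=
      IsBdd.sum _ fun i _ => (hξ i.succ).comp fun y : Fin n → Y => y i
    have hS' : IsBdd fun y : Fin (n + 1) → Y => ∑ i, ξ i (y i) :=
      IsBdd.sum _ fun i _ => (hξ i).comp fun y : Fin (n + 1) → Y => y i
    constructor
    · rw [expect_indepLaw_succ p hS']
      simp only [Fin.sum_univ_succ, Fin.cons_zero, Fin.cons_succ]
      simp only [expect_add (IsBdd.const _) hS, expect_const, ih1, add_zero, h0]
    · rw [expect_indepLaw_succ p (hS'.pow 2)]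
      simp only [Fin.sum_univ_succ, Fin.cons_zero, Fin.cons_succ]
      have e : ∀ a, expect (indepLaw fun i => p i.succ)
          (fun y => (ξ 0 a + ∑ i : Fin n, ξ i.succ (y i)) ^ 2) =
          ξ 0 a ^ 2 + ∑ i : Fin n, expect (p i.succ) fun y => ξ i.succ y ^ 2 := fun a => by
        simp only [show ∀ x y : ℝ, (x + y) ^ 2 = x ^ 2 + ((2 * x) * y + y ^ 2) by intros; ring]
        rw [expect_add (IsBdd.const _) ((hS.const_mul _).add (hS.pow 2)),
          expect_add (hS.const_mul _) (hS.pow 2), expect_const, expect_const_mul, ih1, ih2]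
        ring
      simp only [e]
      rw [expect_add ((hξ 0).pow 2) (IsBdd.const _), expect_const]

/-- Terms linear in the new summand or in the old sum vanish, and the rest is at most `v² + 6 v V +
3 V² ≤ 3 (v + V)²`. The pointwise bound on the squares controls the fourth moment of the new summand
by `v²`. -/
theorem expect_sum_pow_four_indepLaw {b : ℝ} : ∀ (n : ℕ) (p : Fin n → PMF Y)
    (ξ : Fin n → Y → ℝ) (v : Fin n → ℝ),
    (∀ i y, |ξ i y| ≤ b) → (∀ i y, ξ i y ^ 2 ≤ v i) → (∀ i, expect (p i) (ξ i) = 0) →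
    expect (indepLaw p) (fun y => (∑ i, ξ i (y i)) ^ 4) ≤ 3 * (∑ i, v i) ^ 2
  | 0, p, ξ, v, _, _, _ => by simp [expect_const]
  | n + 1, p, ξ, v, hb, hv, h0 => by
    have ih := expect_sum_pow_four_indepLaw n (fun i => p i.succ) (fun i => ξ i.succ)
      (fun i => v i.succ) (fun i => hb i.succ) (fun i => hv i.succ) fun i => h0 i.succ
    obtain ⟨ih1, ih2⟩ := expect_sum_sq_indepLaw n (fun i => p i.succ) (fun i => ξ i.succ)
      (fun i => hb i.succ) fun i => h0 i.succ
    have hξ : ∀ i, IsBdd (ξ i) := fun i => ⟨b, hb i⟩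
    have hS : IsBdd fun y : Fin n → Y => ∑ i, ξ i.succ (y i) :=
      IsBdd.sum _ fun i _ => (hξ i.succ).comp fun y : Fin n → Y => y i
    have hS' : IsBdd fun y : Fin (n + 1) → Y => ∑ i, ξ i (y i) :=
      IsBdd.sum _ fun i _ => (hξ i).comp fun y : Fin (n + 1) → Y => y i
    set q := indepLaw fun i => p (Fin.succ i) with hq
    set S : (Fin n → Y) → ℝ := fun y => ∑ i, ξ i.succ (y i) with hSdef
    set V : ℝ := ∑ i : Fin n, v i.succ with hV
    have hS2 : expect q (fun y => S y ^ 2) ≤ V := by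
      rw [ih2]
      exact Finset.sum_le_sum fun i _ => expect_le_of_le ((hξ i.succ).pow 2) (hv i.succ)
    rw [expect_indepLaw_succ p (hS'.pow 4), Fin.sum_univ_succ]
    simp only [Fin.sum_univ_succ, Fin.cons_zero, Fin.cons_succ]
    have e : ∀ a, expect q (fun y => (ξ 0 a + S y) ^ 4) =
        ξ 0 a ^ 4 + (6 * expect q (fun y => S y ^ 2) * ξ 0 a ^ 2 +
          (4 * expect q (fun y => S y ^ 3) * ξ 0 a + expect q fun y => S y ^ 4)) := fun a => by
      simp only [show ∀ x y : ℝ, (x + y) ^ 4 = x ^ 4 + ((4 * x ^ 3) * y + ((6 * x ^ 2) * y ^ 2 +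
        ((4 * x) * y ^ 3 + y ^ 4))) by intros; ring]
      have b3 := ((hS.pow 3).const_mul (4 * ξ 0 a)).add (hS.pow 4)
      have b2 := ((hS.pow 2).const_mul (6 * ξ 0 a ^ 2)).add b3
      rw [expect_add (IsBdd.const _) ((hS.const_mul _).add b2),
        expect_add (hS.const_mul _) b2, expect_add ((hS.pow 2).const_mul _) b3,
        expect_add ((hS.pow 3).const_mul _) (hS.pow 4), expect_const]
      simp only [expect_const_mul]
      rw [ih1]
      ring
    have hle : expect (p 0) (fun a => expect q fun y => (ξ 0 a + S y) ^ 4) =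
        expect (p 0) (fun a => ξ 0 a ^ 4) +
          (6 * expect q (fun y => S y ^ 2) * expect (p 0) (fun a => ξ 0 a ^ 2) +
            expect q fun y => S y ^ 4) := by
      simp only [e]
      have b1 := ((hξ 0).const_mul (4 * expect q fun y => S y ^ 3)).add
        (IsBdd.const (expect q fun y => S y ^ 4))
      rw [expect_add ((hξ 0).pow 4) ((((hξ 0).pow 2).const_mul _).add b1),
        expect_add (((hξ 0).pow 2).const_mul _) b1,
        expect_add ((hξ 0).const_mul _) (IsBdd.const _), expect_const, expect_const_mul,
        expect_const_mul, h0]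
      ring
    refine hle.trans_le ?_
    have h4 : expect (p 0) (fun a => ξ 0 a ^ 4) ≤ v 0 ^ 2 :=
      expect_le_of_le ((hξ 0).pow 4) fun a => by
        have := pow_le_pow_left₀ (sq_nonneg _) (hv 0 a) 2
        rwa [← pow_mul] at this
    have h2 : expect (p 0) (fun a => ξ 0 a ^ 2) ≤ v 0 := expect_le_of_le ((hξ 0).pow 2) (hv 0)
    have h2' : 0 ≤ expect (p 0) (fun a => ξ 0 a ^ 2) :=
      le_expect_of_le ((hξ 0).pow 2) fun a => sq_nonneg _
    have hS2' : 0 ≤ expect q (fun y => S y ^ 2) :=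
      le_expect_of_le (hS.pow 2) fun a => sq_nonneg _
    have := mul_le_mul hS2 h2 h2' (hS2'.trans hS2)
    nlinarith [sq_nonneg (v 0)]

/-! ## Inverse moments of the binomial law -/

/-- The number of indices flagged by `c`. -/
def flagCount (c : Fin m → Bool) : ℕ := ∑ i, if c i then 1 else 0

theorem expect_flagCount_succ (β : PMF Bool) (ψ : ℕ → ℝ) :
    expect (indepLaw fun _ : Fin (m + 1) => β) (fun c => ψ (flagCount c)) =
      (β true).toReal * expect (indepLaw fun _ : Fin m => β) (fun c => ψ (flagCount c + 1)) +
      (β false).toReal * expect (indepLaw fun _ : Fin m => β) fun c => ψ (flagCount c) := by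
  rw [expect_indepLaw_succ _ (IsBdd.of_finite _), expect, tsum_bool, add_comm]
  simp only [flagCount, Fin.sum_univ_succ, Fin.cons_zero, Fin.cons_succ]
  simp [add_comm]

/-- The size-bias identity of the binomial law: requiring one given index to be flagged leaves `m`
free flags. Choosing `ψ` as a reciprocal turns it into an inverse moment bound. -/
theorem expect_flagCount_mul (β : PMF Bool) : ∀ (m : ℕ) (ψ : ℕ → ℝ),
    (β true).toReal * (m + 1) *
        expect (indepLaw fun _ : Fin m => β) (fun c => ψ (flagCount c + 1)) =
      expect (indepLaw fun _ : Fin (m + 1) => β) fun c => flagCount c * ψ (flagCount c)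
  | 0, ψ => by
    rw [expect_flagCount_succ β fun k => k * ψ k]
    simp [flagCount, expect_const]
  | m + 1, ψ => by
    rw [expect_flagCount_succ β fun k => k * ψ k, ← expect_flagCount_mul β m ψ]
    have h : expect (indepLaw fun _ : Fin (m + 1) => β)
        (fun c => ((flagCount c + 1 : ℕ) : ℝ) * ψ (flagCount c + 1)) =
        expect (indepLaw fun _ : Fin (m + 1) => β) (fun c => flagCount c * ψ (flagCount c + 1)) +
        expect (indepLaw fun _ : Fin (m + 1) => β) fun c => ψ (flagCount c + 1) := by
      rw [← expect_add (IsBdd.of_finite _) (IsBdd.of_finite _)]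
      simp only [Nat.cast_add, Nat.cast_one, add_mul, one_mul]
    rw [h, ← expect_flagCount_mul β m fun k => ψ (k + 1),
      expect_flagCount_succ β fun k => ψ (k + 1)]
    push_cast
    ring

theorem expect_inv_flagCount_le (β : PMF Bool) (hβ : 0 < (β true).toReal) (m : ℕ) :
    expect (indepLaw fun _ : Fin m => β) (fun c => ((flagCount c : ℝ) + 1)⁻¹) ≤
      ((β true).toReal * (m + 1))⁻¹ := by
  have hpos : 0 < (β true).toReal * (m + 1) := by positivity
  have h := expect_flagCount_mul β m fun k => (k : ℝ)⁻¹
  have h1 : expect (indepLaw fun _ : Fin (m + 1) => β)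
      (fun c => (flagCount c : ℝ) * (flagCount c : ℝ)⁻¹) ≤ 1 :=
    expect_le_of_le (IsBdd.of_finite _) fun c => mul_inv_le_one
  rw [← h] at h1
  rw [← one_div, le_div_iff₀ hpos, mul_comm]
  simpa using h1

/-- Compare `1 / (N + 1)²` with `2 / ((N + 1) (N + 2))`, then use size bias with `ψ k = 1 / (k (k +
1))`, which leaves a first inverse moment for `m + 1` flags. -/
theorem expect_inv_flagCount_sq_le (β : PMF Bool) (hβ : 0 < (β true).toReal) (m : ℕ) :
    expect (indepLaw fun _ : Fin m => β) (fun c => (((flagCount c : ℝ) + 1) ^ 2)⁻¹) ≤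
      2 * (((β true).toReal * (m + 1)) ^ 2)⁻¹ := by
  have hpos : 0 < (β true).toReal * (m + 1) := by positivity
  have h := expect_flagCount_mul β m fun k => ((k : ℝ) * (k + 1))⁻¹
  have h1 : expect (indepLaw fun _ : Fin (m + 1) => β)
      (fun c => (flagCount c : ℝ) * ((flagCount c : ℝ) * (flagCount c + 1))⁻¹) ≤
      ((β true).toReal * (m + 1))⁻¹ := by
    refine (expect_mono (IsBdd.of_finite _) (IsBdd.of_finite _) fun c => ?_).trans
      ((expect_inv_flagCount_le β hβ (m + 1)).trans ?_)
    · rw [mul_inv, ← mul_assoc]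
      exact mul_le_of_le_one_left (by positivity) mul_inv_le_one
    · gcongr
      linarith
  rw [← h] at h1
  have h2 : expect (indepLaw fun _ : Fin m => β) (fun c => (((flagCount c : ℝ) + 1) ^ 2)⁻¹) ≤
      2 * expect (indepLaw fun _ : Fin m => β)
        (fun c => (((flagCount c + 1 : ℕ) : ℝ) * ((flagCount c + 1 : ℕ) + 1))⁻¹) := by
    rw [← expect_const_mul]
    refine expect_mono (IsBdd.of_finite _) (IsBdd.of_finite _) fun c => ?_
    push_cast
    have hk : (0 : ℝ) ≤ flagCount c := Nat.cast_nonneg _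
    rw [← div_eq_mul_inv, ← one_div, div_le_div_iff₀ (by positivity) (by positivity)]
    nlinarith
  refine h2.trans (mul_le_mul_of_nonneg_left ?_ zero_le_two)
  rw [pow_two, mul_inv, ← div_eq_inv_mul, le_div_iff₀ hpos, mul_comm]
  exact h1

end IndepLaw

/-! ## The privacy blanket -/

section Blanket

variable {X Y : Type*} {R : X → PMF Y} {ε₀ : ℝ}

theorem IsLDP.apply_le (hR : IsLDP R ε₀) (x x' : X) (y : Y) :
    (R x y).toReal ≤ Real.exp ε₀ * (R x' y).toReal := by
  simpa [PMF.toOuterMeasure_apply_singleton] using hR x x' {y}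

theorem IsLDP.nonneg [Nonempty X] (hR : IsLDP R ε₀) : 0 ≤ ε₀ := by
  obtain ⟨x⟩ := ‹Nonempty X›
  have h := hR x x Set.univ
  have h1 : (R x).toOuterMeasure Set.univ = 1 :=
    ((R x).toOuterMeasure_apply_eq_one_iff _).2 (Set.subset_univ _)
  rw [h1] at h
  simpa using h

/-- The common part `ω` of the laws `R x`, of mass `β true`, and the residual laws `ρ x`. -/
theorem IsLDP.exists_blanket [Nonempty X] (hR : IsLDP R ε₀) :
    ∃ (β : PMF Bool) (ω : PMF Y) (ρ : X → PMF Y), 0 < (β true).toReal ∧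
      (∀ x, R x = β.bind fun b => if b then ω else ρ x) ∧
      ∀ x y, (R x y).toReal ≤ Real.exp ε₀ * (β true).toReal * (ω y).toReal := by
  classical
  set e : ENNReal := ENNReal.ofReal (Real.exp ε₀) with he
  have he0 : e ≠ 0 := by simpa [he] using Real.exp_pos ε₀
  have het : e ≠ ⊤ := ENNReal.ofReal_ne_top
  set μ : Y → ENNReal := fun y => ⨅ x, R x y with hμ
  have hμR : ∀ x y, μ y ≤ R x y := fun x y => iInf_le _ x
  have hRμ : ∀ x y, R x y ≤ e * μ y := fun x y => by
    rw [hμ, ENNReal.mul_iInf_of_ne he0 het]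
    refine le_iInf fun x' => ?_
    rw [← ENNReal.toReal_le_toReal ((R x).apply_ne_top y)
      (ENNReal.mul_ne_top het ((R x').apply_ne_top y)), ENNReal.toReal_mul, he,
      ENNReal.toReal_ofReal (Real.exp_pos _).le]
    exact hR.apply_le x x' y
  obtain ⟨x₀⟩ := ‹Nonempty X›
  set γ : ENNReal := ∑' y, μ y with hγ
  have hγ1 : γ ≤ 1 := (ENNReal.tsum_le_tsum (hμR x₀)).trans_eq (R x₀).tsum_coe
  have hγt : γ ≠ ⊤ := ne_top_of_le_ne_top ENNReal.one_ne_top hγ1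
  -- Summing `R x₀ y ≤ e * μ y` over `y` gives `1 ≤ e * γ`.
  have hγ0 : γ ≠ 0 := fun h0 => by
    have h := ENNReal.tsum_le_tsum (hRμ x₀)
    rw [(R x₀).tsum_coe, ENNReal.tsum_mul_left, ← hγ, h0, mul_zero] at h
    exact one_ne_zero (nonpos_iff_eq_zero.1 h)
  have hres : ∀ x, ∑' y, (R x y - μ y) = 1 - γ := fun x => by
    refine ENNReal.eq_sub_of_add_eq hγt ?_
    rw [hγ, ← ENNReal.tsum_add, ← (R x).tsum_coe]
    exact tsum_congr fun y => tsub_add_cancel_of_le (hμR x y)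
  set ω : PMF Y := PMF.normalize μ hγ0 hγt with hω
  have hωa : ∀ y, γ * ω y = μ y := fun y => by
    rw [hω, PMF.normalize_apply, mul_left_comm, ENNReal.mul_inv_cancel hγ0 hγt, mul_one]
  have hρ : ∀ x, ∃ ρ : PMF Y, ∀ y, (1 - γ) * ρ y = R x y - μ y := fun x => by
    by_cases h1 : 1 - γ = 0
    · refine ⟨ω, fun y => ?_⟩
      have h := hres x
      rw [h1, ENNReal.tsum_eq_zero] at h
      rw [h1, h y, zero_mul]
    · have h1t : 1 - γ ≠ ⊤ := ENNReal.sub_ne_top ENNReal.one_ne_top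
      refine ⟨PMF.normalize (fun y => R x y - μ y) (by rwa [hres x]) (by rwa [hres x]),
        fun y => ?_⟩
      rw [PMF.normalize_apply, hres x, mul_left_comm, ENNReal.mul_inv_cancel h1 h1t, mul_one]
  choose ρ hρ using hρ
  set β : PMF Bool := PMF.ofFintype (fun b => bif b then γ else 1 - γ)
    (by simpa using add_tsub_cancel_of_le hγ1)
  have hβt : β true = γ := rfl
  have hβf : β false = 1 - γ := rfl
  refine ⟨β, ω, ρ, ?_, fun x => PMF.ext fun y => ?_, fun x y => ?_⟩
  · rw [hβt]
    exact ENNReal.toReal_pos hγ0 hγt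
  · rw [PMF.bind_apply, tsum_fintype, Fintype.sum_bool, hβt, hβf]
    simp only [if_true, Bool.false_eq_true, if_false]
    rw [hωa, hρ, add_tsub_cancel_of_le (hμR x y)]
  · rw [hβt, mul_assoc, ← ENNReal.toReal_mul, hωa, ← ENNReal.toReal_ofReal (Real.exp_pos ε₀).le,
      ← ENNReal.toReal_mul]
    exact ENNReal.toReal_mono (ENNReal.mul_ne_top het
      (ne_top_of_le_ne_top ((R x).apply_ne_top y) (hμR x y))) (hRμ x y)

end Blanket

/-! ## Averages of likelihood ratios -/

/-- For `u ≥ 1`, `log u ≤ sinh (log u) = (u - 1/u) / 2` already gives the quadratic part. For `u ≤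
1`, `log (1 + x) ≥ 2x / (x + 2)` at `x = 1/u - 1` leaves a cubic remainder. -/
theorem mul_log_le_cubic {u : ℝ} (hu : 0 ≤ u) :
    u * Real.log u ≤ (u - 1) + (u - 1) ^ 2 / 2 + |u - 1| ^ 3 / 2 := by
  rcases hu.eq_or_lt with rfl | hu
  · norm_num
  rcases le_total 1 u with h1 | h1
  · have h := Real.self_le_sinh_iff.2 (Real.log_nonneg h1)
    rw [Real.sinh_log hu] at h
    have h2 := mul_le_mul_of_nonneg_left h hu.le
    have h3 : u * ((u - u⁻¹) / 2) = (u - 1) + (u - 1) ^ 2 / 2 := by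
      field_simp
      ring
    have h4 : 0 ≤ |u - 1| ^ 3 := by positivity
    linarith
  · have h := Real.le_log_one_add_of_nonneg (x := u⁻¹ - 1)
      (by linarith [(one_le_inv₀ hu).2 h1])
    rw [add_sub_cancel, Real.log_inv] at h
    have h2 : 2 * (u⁻¹ - 1) / (u⁻¹ - 1 + 2) = 2 * (1 - u) / (1 + u) := by
      have : u⁻¹ - 1 + 2 = (1 + u) / u := by
        field_simp
        ring
      rw [this]
      field_simp
    rw [h2] at h
    have h3 : Real.log u ≤ -(2 * (1 - u) / (1 + u)) := by linarith
    have h4 := mul_le_mul_of_nonneg_left h3 hu.le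
    refine h4.trans ?_
    rw [abs_of_nonpos (by linarith), mul_neg, neg_le, mul_div_assoc', le_div_iff₀ (by linarith)]
    have h5 : 0 ≤ (1 - u) ^ 3 * u := mul_nonneg (pow_nonneg (by linarith) 3) hu.le
    nlinarith

/-- The cubic term is split by `(u - 1)² (κ - |u - 1|)² ≥ 0`, so that only even moments are needed;
`κ` is tuned later. -/
theorem mul_log_le_quartic {u κ : ℝ} (hu : 0 ≤ u) (hκ : 0 < κ) :
    u * Real.log u ≤ (u - 1) + ((1 / 2 + κ / 4) * (u - 1) ^ 2 + (4 * κ)⁻¹ * (u - 1) ^ 4) := by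
  refine (mul_log_le_cubic hu).trans ?_
  have h : 0 ≤ (u - 1) ^ 2 * (κ - |u - 1|) ^ 2 / (4 * κ) := by positivity
  have h2 : (u - 1) ^ 2 * (κ - |u - 1|) ^ 2 / (4 * κ) =
      κ / 4 * (u - 1) ^ 2 + (4 * κ)⁻¹ * (u - 1) ^ 4 - |u - 1| ^ 3 / 2 := by
    rw [← sq_abs (u - 1), show (u - 1) ^ 4 = |u - 1| ^ 4 by
      rw [show (4 : ℕ) = 2 * 2 from rfl, pow_mul, pow_mul, sq_abs]]
    field_simp
    ring
  linarith

section Average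

variable {Y : Type*} {m : ℕ}

/-- The law of independent messages `y₀ ∼ ω` and `yᵢ₊₁ ∼ ω` or `yᵢ₊₁ ∼ ρ i`, as flagged by `c`. -/
noncomputable def flaggedLaw (ω : PMF Y) (ρ : Fin m → PMF Y) (c : Fin m → Bool) :
    PMF (Fin (m + 1) → Y) :=
  indepLaw (Fin.cons ω fun i => if c i then ω else ρ i)

/-- The average of `l` over the message `y₀` and the messages flagged by `c`. -/
noncomputable def flaggedAvg (l : Y → ℝ) (c : Fin m → Bool) (y : Fin (m + 1) → Y) : ℝ :=
  (l (y 0) + ∑ i : Fin m, if c i then l (y i.succ) else 0) / (flagCount c + 1)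

theorem flaggedAvg_nonneg {l : Y → ℝ} (hl : ∀ y, 0 ≤ l y) (c : Fin m → Bool)
    (y : Fin (m + 1) → Y) : 0 ≤ flaggedAvg l c y := by
  refine div_nonneg (add_nonneg (hl _) (Finset.sum_nonneg fun i _ => ?_)) (by positivity)
  split_ifs
  exacts [hl _, le_rfl]

theorem flaggedAvg_le {l : Y → ℝ} {B : ℝ} (hl : ∀ y, l y ≤ B) (c : Fin m → Bool)
    (y : Fin (m + 1) → Y) : flaggedAvg l c y ≤ B := by
  rw [flaggedAvg, div_le_iff₀ (by positivity), mul_add, mul_one, add_comm]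
  refine add_le_add ?_ (hl _)
  rw [flagCount, Nat.cast_sum, Finset.mul_sum]
  refine Finset.sum_le_sum fun i _ => ?_
  split_ifs
  · simpa using hl _
  · simp

theorem flaggedAvg_sub_one (l : Y → ℝ) (c : Fin m → Bool) (y : Fin (m + 1) → Y) :
    flaggedAvg l c y - 1 = ((flagCount c : ℝ) + 1)⁻¹ *
      ∑ i, (Fin.cons (fun y => l y - 1) (fun i y => if c i then l y - 1 else 0) :
        Fin (m + 1) → Y → ℝ) i (y i) := by
  have hN : ((flagCount c : ℝ) + 1) ≠ 0 := by positivity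
  have h : ∑ i : Fin m, (if c i then l (y i.succ) - 1 else 0) =
      (∑ i : Fin m, if c i then l (y i.succ) else 0) - flagCount c := by
    rw [flagCount, Nat.cast_sum, ← Finset.sum_sub_distrib]
    exact Finset.sum_congr rfl fun i _ => by split_ifs <;> simp
  rw [Fin.sum_univ_succ]
  simp only [Fin.cons_zero, Fin.cons_succ]
  rw [h, flaggedAvg]
  field_simp
  ring

/-- Given the flags, the deviation from 1 is a normalized sum of `flagCount c + 1` independent
centred terms. Unflagged positions contribute zero, so the residual laws play no role. -/
theorem expect_flaggedAvg {ω : PMF Y} (ρ : Fin m → PMF Y) {l : Y → ℝ} {b : ℝ}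
    (hb : ∀ y, |l y - 1| ≤ b) (h0 : expect ω (fun y => l y - 1) = 0) (c : Fin m → Bool) :
    expect (flaggedLaw ω ρ c) (fun y => flaggedAvg l c y - 1) = 0 ∧
    expect (flaggedLaw ω ρ c) (fun y => (flaggedAvg l c y - 1) ^ 2) =
      ((flagCount c : ℝ) + 1)⁻¹ * expect ω (fun y => (l y - 1) ^ 2) ∧
    expect (flaggedLaw ω ρ c) (fun y => (flaggedAvg l c y - 1) ^ 4) ≤
      3 * b ^ 4 * (((flagCount c : ℝ) + 1) ^ 2)⁻¹ := by
  set ξ : Fin (m + 1) → Y → ℝ :=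
    Fin.cons (fun y => l y - 1) (fun i y => if c i then l y - 1 else 0) with hξ
  set N : ℝ := (flagCount c : ℝ) + 1 with hN
  have hNpos : 0 < N := by positivity
  have hcount : ((flagCount c : ℕ) : ℝ) = ∑ i : Fin m, if c i then (1 : ℝ) else 0 := by
    rw [flagCount, Nat.cast_sum]
    exact Finset.sum_congr rfl fun i _ => by split_ifs <;> simp
  have hξb : ∀ i y, |ξ i y| ≤ b := fun i y => by
    refine Fin.cases ?_ (fun i => ?_) i
    · exact hb y
    · simp only [hξ, Fin.cons_succ]
      split_ifs
      · exact hb y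
      · simpa using (abs_nonneg _).trans (hb y)
  have hξ0 : ∀ i, expect ((Fin.cons ω fun i => if c i then ω else ρ i : Fin (m + 1) → PMF Y) i)
      (ξ i) = 0 := fun i => by
    refine Fin.cases ?_ (fun i => ?_) i
    · exact h0
    · simp only [hξ, Fin.cons_succ]
      by_cases hc : c i = true
      · simpa [hc] using h0
      · simp [hc, expect_const]
  have hξv : ∀ i y, ξ i y ^ 2 ≤ (Fin.cons (b ^ 2) fun i => if c i then b ^ 2 else 0 :
      Fin (m + 1) → ℝ) i := fun i y => by
    refine Fin.cases ?_ (fun i => ?_) i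
    · exact sq_le_sq' (abs_le.1 (hb y)).1 (abs_le.1 (hb y)).2
    · simp only [hξ, Fin.cons_succ]
      split_ifs
      · exact sq_le_sq' (abs_le.1 (hb y)).1 (abs_le.1 (hb y)).2
      · simp
  obtain ⟨h1, h2⟩ := expect_sum_sq_indepLaw (m + 1) _ ξ hξb hξ0
  have h4 := expect_sum_pow_four_indepLaw (m + 1) _ ξ _ hξb hξv hξ0
  simp only [flaggedAvg_sub_one, mul_pow, expect_const_mul, flaggedLaw]
  rw [← hξ, ← hN]
  refine ⟨?_, ?_, ?_⟩
  · rw [h1, mul_zero]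
  · rw [h2, Fin.sum_univ_succ]
    have h5 : ∀ i : Fin m, expect ((Fin.cons ω fun i => if c i then ω else ρ i :
        Fin (m + 1) → PMF Y) i.succ) (fun y => ξ i.succ y ^ 2) =
        expect ω (fun y => (l y - 1) ^ 2) * if c i then 1 else 0 := fun i => by
      simp only [hξ, Fin.cons_succ]
      by_cases hc : c i = true
      · simp [hc]
      · simp [hc, expect_const]
    have h6 : expect ((Fin.cons ω fun i => if c i then ω else ρ i : Fin (m + 1) → PMF Y) 0)
        (fun y => ξ 0 y ^ 2) = expect ω fun y => (l y - 1) ^ 2 := rfl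
    rw [h6, Finset.sum_congr rfl fun i _ => h5 i, ← Finset.mul_sum, ← hcount]
    have : expect ω (fun y => (l y - 1) ^ 2) + expect ω (fun y => (l y - 1) ^ 2) * flagCount c =
      N * expect ω (fun y => (l y - 1) ^ 2) := by
      rw [hN]
      ring
    rw [this]
    field_simp
  · refine (mul_le_mul_of_nonneg_left h4 (by positivity)).trans_eq ?_
    rw [Fin.sum_univ_succ]
    have h5 : ∀ i : Fin m, (if c i then b ^ 2 else 0) = b ^ 2 * if c i then 1 else 0 := fun i => by
      split_ifs <;> simp
    simp only [Fin.cons_zero, Fin.cons_succ, h5]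
    rw [← Finset.mul_sum, ← hcount]
    have : b ^ 2 + b ^ 2 * flagCount c = N * b ^ 2 := by
      rw [hN]
      ring
    rw [this]
    field_simp

/-- The relative entropy bound for the average of likelihood ratios over a random set of
messages. -/
theorem expect_flaggedAvg_mul_log_le {β : PMF Bool} (hβ : 0 < (β true).toReal) {ω : PMF Y}
    (ρ : Fin m → PMF Y) {l : Y → ℝ} {ε b : ℝ} (hl0 : ∀ y, 0 ≤ l y)
    (hl : ∀ y, l y ≤ Real.exp ε * (β true).toReal) (hl1 : expect ω l = 1)
    (hb : ∀ y, |l y - 1| ≤ b) :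
    expect (indepLaw fun _ : Fin m => β) (fun c => expect (flaggedLaw ω ρ c)
      fun y => flaggedAvg l c y * Real.log (flaggedAvg l c y)) ≤
    leakageBound ε ((Real.exp ε - 1 + 6 * b ^ 4 / (β true).toReal ^ 2) / 4) (m + 1) := by
  set γ := (β true).toReal with hγ
  set n : ℝ := (m : ℝ) + 1 with hn
  have hnpos : 0 < n := by positivity
  have hlb : IsBdd l := ⟨Real.exp ε * γ, fun y => by rw [abs_of_nonneg (hl0 y)]; exact hl y⟩
  have hl1' : expect ω (fun y => l y - 1) = 0 := by
    rw [expect_sub hlb (IsBdd.const 1), hl1, expect_const, sub_self]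
  set V := expect ω (fun y => (l y - 1) ^ 2) with hV
  have hVle : V ≤ Real.exp ε * γ - 1 := by
    have e1 : V = expect ω (fun y => l y ^ 2) - 1 := by
      -- The variance is the second moment minus 1, and the second moment is at most the supremum of
      -- `l` times its mean.
      simp only [hV, show ∀ x : ℝ, (x - 1) ^ 2 = x ^ 2 - (2 * x - 1) by intros; ring]
      rw [expect_sub (hlb.pow 2) ((hlb.const_mul 2).sub (IsBdd.const 1)),
        expect_sub (hlb.const_mul 2) (IsBdd.const 1), expect_const_mul, hl1, expect_const]
      norm_num
    have e2 : expect ω (fun y => l y ^ 2) ≤ Real.exp ε * γ := by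
      refine (expect_mono (hlb.pow 2) (hlb.const_mul (Real.exp ε * γ)) fun y => ?_).trans_eq ?_
      · rw [pow_two]
        exact mul_le_mul_of_nonneg_right (hl y) (hl0 y)
      · rw [expect_const_mul, hl1, mul_one]
    linarith
  have hV0 : 0 ≤ V := le_expect_of_le ((hlb.sub (IsBdd.const 1)).pow 2) fun y => sq_nonneg _
  -- This choice balances the errors `κ / n` and `1 / (κ n²)`: both have order `n ^ (-3/2)`.
  set κ : ℝ := n ^ (-(1 / 2) : ℝ) with hκ
  have hκpos : 0 < κ := Real.rpow_pos_of_pos hnpos _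
  have hc : ∀ c : Fin m → Bool, expect (flaggedLaw ω ρ c)
      (fun y => flaggedAvg l c y * Real.log (flaggedAvg l c y)) ≤
      (1 / 2 + κ / 4) * V * ((flagCount c : ℝ) + 1)⁻¹ +
        (4 * κ)⁻¹ * (3 * b ^ 4) * (((flagCount c : ℝ) + 1) ^ 2)⁻¹ := fun c => by
    obtain ⟨h1, h2, h4⟩ := expect_flaggedAvg ρ hb hl1' c
    have hA0 := flaggedAvg_nonneg hl0 c
    have hAb : IsBdd (flaggedAvg l c) := ⟨Real.exp ε * γ, fun y => by
      rw [abs_of_nonneg (hA0 y)]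
      exact flaggedAvg_le hl c y⟩
    have hDb := hAb.sub (IsBdd.const 1)
    have b2 := (hDb.pow 2).const_mul (1 / 2 + κ / 4)
    have b4 := (hDb.pow 4).const_mul (4 * κ)⁻¹
    refine (expect_mono (IsBdd.mul_log hA0 hAb) (hDb.add (b2.add b4)) fun y =>
      mul_log_le_quartic (hA0 y) hκpos).trans ?_
    rw [expect_add hDb (b2.add b4), expect_add b2 b4, expect_const_mul, expect_const_mul, h1, h2]
    have := mul_le_mul_of_nonneg_left h4 (inv_nonneg.2 (mul_pos four_pos hκpos).le)
    linarith
  refine (expect_mono (IsBdd.of_finite _) (IsBdd.of_finite _) hc).trans ?_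
  rw [expect_add (IsBdd.of_finite _) (IsBdd.of_finite _), expect_const_mul, expect_const_mul]
  have i1 := mul_le_mul_of_nonneg_left (expect_inv_flagCount_le β hβ m)
    (mul_nonneg (by positivity : 0 ≤ 1 / 2 + κ / 4) hV0)
  have i2 := mul_le_mul_of_nonneg_left (expect_inv_flagCount_sq_le β hβ m)
    (by positivity : 0 ≤ (4 * κ)⁻¹ * (3 * b ^ 4))
  -- Since `V / γ ≤ exp ε - 1 / γ` and `γ ≤ 1`, the blanket mass disappears from the leading term.
  have i3 : V * (γ * n)⁻¹ ≤ (Real.exp ε - 1) * n⁻¹ := by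
    have hγ1 : γ ≤ 1 := ENNReal.toReal_le_of_le_ofReal zero_le_one (by simpa using β.coe_le_one _)
    rw [mul_inv, ← mul_assoc]
    refine mul_le_mul_of_nonneg_right ?_ (by positivity)
    rw [← div_eq_mul_inv, div_le_iff₀ hβ]
    linarith
  have i4 := mul_le_mul_of_nonneg_left i3 (by positivity : 0 ≤ 1 / 2 + κ / 4)
  have k1 : n ^ (-(3 / 2) : ℝ) = κ * n⁻¹ := by
    rw [hκ, ← Real.rpow_neg_one, ← Real.rpow_add hnpos]
    norm_num
  have k2 : κ * κ = n⁻¹ := by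
    rw [hκ, ← Real.rpow_neg_one, ← Real.rpow_add hnpos]
    norm_num
  have k3 : κ⁻¹ * (n⁻¹ * n⁻¹) = κ * n⁻¹ := by
    rw [← k2]
    field_simp
  rw [leakageBound]
  push_cast
  rw [← hn, k1]
  calc _ ≤ (1 / 2 + κ / 4) * ((Real.exp ε - 1) * n⁻¹) +
        (4 * κ)⁻¹ * (3 * b ^ 4) * (2 * ((γ * n) ^ 2)⁻¹) := by linarith
    _ = (Real.exp ε - 1) / (2 * n) + ((Real.exp ε - 1) / 4 * (κ * n⁻¹) +
        6 * b ^ 4 / γ ^ 2 / 4 * (κ⁻¹ * (n⁻¹ * n⁻¹))) := by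
        field_simp
        ring
    _ = _ := by
        rw [k3]
        ring

end Average

/-! ## The shuffled output as a mixture -/

section Shuffle

variable {X Y : Type*} {n m : ℕ}

theorem bind_apply_le_of_left {α β : Type*} {p q : PMF α} {c : ENNReal}
    (h : ∀ a, p a ≤ c * q a) (k : α → PMF β) (b : β) : p.bind k b ≤ c * q.bind k b := by
  rw [PMF.bind_apply, PMF.bind_apply, ← ENNReal.tsum_mul_left]
  refine ENNReal.tsum_le_tsum fun a => ?_
  rw [← mul_assoc]
  exact mul_le_mul_left (h a) _

theorem bind_apply_le_of_right {α β : Type*} (p : PMF α) {k k' : α → PMF β} {c : ENNReal}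
    {b : β} (h : ∀ a, k a b ≤ c * k' a b) : p.bind k b ≤ c * p.bind k' b := by
  rw [PMF.bind_apply, PMF.bind_apply, ← ENNReal.tsum_mul_left]
  refine ENNReal.tsum_le_tsum fun a => ?_
  rw [mul_left_comm]
  exact mul_le_mul_right (h a) _

/-- The law of the shuffled output for the database `x`. -/
noncomputable def shuffledLaw (R : X → PMF Y) (x : Fin n → X) : PMF (Fin n → Y) :=
  (indepLaw fun i => R (x i)).bind fun y =>
    (PMF.uniformOfFintype (Equiv.Perm (Fin n))).map fun σ i => y (σ i)

/-- The average of `h` over all permutations of the coordinates. -/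
noncomputable def symmetrize (h : (Fin n → Y) → ℝ) (y : Fin n → Y) : ℝ :=
  expect (PMF.uniformOfFintype (Equiv.Perm (Fin n))) fun σ => h fun i => y (σ i)

theorem IsBdd.symmetrize {h : (Fin n → Y) → ℝ} (hh : IsBdd h) : IsBdd (symmetrize h) :=
  IsBdd.expect (hh.imp fun _ hB _ _ => hB _)

theorem symmetrize_comp_perm (h : (Fin n → Y) → ℝ) (y : Fin n → Y) (τ : Equiv.Perm (Fin n)) :
    symmetrize h (fun i => y (τ i)) = symmetrize h y := by
  simp only [symmetrize, expect, PMF.uniformOfFintype_apply]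
  rw [← (Equiv.mulLeft τ).tsum_eq (fun σ : Equiv.Perm (Fin n) =>
    ((Fintype.card (Equiv.Perm (Fin n)) : ENNReal)⁻¹).toReal * h fun i => y (σ i))]
  rfl

theorem expect_shuffledLaw (R : X → PMF Y) (x : Fin n → X) {h : (Fin n → Y) → ℝ} (hh : IsBdd h) :
    expect (shuffledLaw R x) h = expect (indepLaw fun i => R (x i)) (symmetrize h) := by
  rw [shuffledLaw, expect_bind _ _ hh]
  simp only [expect_map _ _ hh]
  rfl

theorem shuffleLaw_map_shuffled {γ : Type*} (R : X → PMF Y) (P : PMF (Fin n → X))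
    (f : (Fin n → X) → γ) :
    (shuffleLaw R P).map (fun ω => (f ω.1, shuffled ω)) =
      P.bind fun x => (shuffledLaw R x).map (Prod.mk (f x)) := by
  simp only [shuffleLaw, shuffledLaw, PMF.map_bind, PMF.map_comp]
  rfl

theorem shuffleLaw_map_fst {γ : Type*} (R : X → PMF Y) (P : PMF (Fin n → X))
    (f : (Fin n → X) → γ) : (shuffleLaw R P).map (fun ω => f ω.1) = P.map f := by
  simp only [shuffleLaw, PMF.map_bind, PMF.map_comp]
  have h : ∀ (x : Fin n → X) (y : Fin n → Y),
      (PMF.uniformOfFintype (Equiv.Perm (Fin n))).map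
        ((fun ω : Outcome X Y n => f ω.1) ∘ fun σ => (x, y, σ)) = PMF.pure (f x) :=
    fun x y => PMF.map_const (PMF.uniformOfFintype (Equiv.Perm (Fin n))) (f x)
  simp only [h, PMF.bind_const]
  rfl

theorem comp_cons (R : X → PMF Y) (a : X) (w : Fin m → X) :
    (fun i => R ((Fin.cons a w : Fin (m + 1) → X) i)) = Fin.cons (R a) fun i => R (w i) := by
  funext i
  refine Fin.cases ?_ (fun i => ?_) i <;> simp

/-- The two product laws differ in one factor only, and shuffling is post-processing. -/
theorem shuffledLaw_cons_le {R : X → PMF Y} {ε₀ : ℝ} (hR : IsLDP R ε₀) (a a' : X)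
    (w : Fin m → X) (z : Fin (m + 1) → Y) :
    shuffledLaw R (Fin.cons a w) z ≤
      ENNReal.ofReal (Real.exp ε₀) * shuffledLaw R (Fin.cons a' w) z := by
  refine bind_apply_le_of_left (fun y => ?_) _ z
  simp only [indepLaw_apply, Fin.prod_univ_succ, Fin.cons_zero, Fin.cons_succ]
  rw [← mul_assoc]
  refine mul_le_mul_left ?_ _
  rw [← ENNReal.ofReal_toReal ((R a).apply_ne_top (y 0)),
    ← ENNReal.ofReal_toReal ((R a').apply_ne_top (y 0)), ← ENNReal.ofReal_mul (Real.exp_pos _).le]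
  exact ENNReal.ofReal_le_ofReal (hR.apply_le a a' (y 0))

/-- Positions `0` and `i.succ` both carry law `ω`, so their transposition preserves the product law,
and `H` is symmetric. -/
theorem expect_flaggedLaw_swap (ω : PMF Y) (ρ : Fin m → PMF Y) (c : Fin m → Bool) {i : Fin m}
    (hi : c i = true) (l : Y → ℝ) {H : (Fin (m + 1) → Y) → ℝ}
    (hH : ∀ y (τ : Equiv.Perm (Fin (m + 1))), H (fun i => y (τ i)) = H y) :
    expect (flaggedLaw ω ρ c) (fun y => l (y i.succ) * H y) =
      expect (flaggedLaw ω ρ c) fun y => l (y 0) * H y := by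
  rw [flaggedLaw, ← expect_indepLaw_comp_perm _ (Equiv.swap 0 i.succ) _ fun y => l (y i.succ) * H y]
  · simp only [Equiv.swap_apply_right, hH]
  · intro j
    rcases eq_or_ne j 0 with rfl | h0
    · simp [hi]
    rcases eq_or_ne j i.succ with rfl | h1
    · simp [hi]
    · rw [Equiv.swap_apply_of_ne_of_ne h0 h1]

/-- The amplification step: a symmetric observer cannot tell which of the messages drawn from `ω`
carries the density, so averaging it is free and divides its variance by their number. -/
theorem expect_flaggedAvg_mul (ω : PMF Y) (ρ : Fin m → PMF Y) (c : Fin m → Bool) {l : Y → ℝ}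
    (hl : IsBdd l) {H : (Fin (m + 1) → Y) → ℝ} (hHb : IsBdd H)
    (hH : ∀ y (τ : Equiv.Perm (Fin (m + 1))), H (fun i => y (τ i)) = H y) :
    expect (flaggedLaw ω ρ c) (fun y => flaggedAvg l c y * H y) =
      expect (flaggedLaw ω ρ c) fun y => l (y 0) * H y := by
  set e := expect (flaggedLaw ω ρ c) fun y => l (y 0) * H y with he
  have hterm : ∀ i, IsBdd fun y : Fin (m + 1) → Y => l (y i) * H y := fun i =>
    (hl.comp fun y : Fin (m + 1) → Y => y i).mul hHb
  have hterm' : ∀ i : Fin m, IsBdd fun y : Fin (m + 1) → Y =>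
      if c i then l (y i.succ) * H y else 0 := fun i => by
    by_cases hc : c i = true
    · simpa [hc] using hterm i.succ
    · simpa [hc] using IsBdd.const 0
  have h1 : ∀ y : Fin (m + 1) → Y, flaggedAvg l c y * H y = ((flagCount c : ℝ) + 1)⁻¹ *
      (l (y 0) * H y + ∑ i : Fin m, if c i then l (y i.succ) * H y else 0) := fun y => by
    simp only [flaggedAvg, ← ite_zero_mul, ← Finset.sum_mul]
    ring
  have h2 : ∀ i : Fin m, expect (flaggedLaw ω ρ c)
      (fun y => if c i then l (y i.succ) * H y else 0) = if c i then e else 0 := fun i => by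
    by_cases hc : c i = true
    · simpa [hc] using expect_flaggedLaw_swap ω ρ c hc l hH
    · simp [hc, expect_const]
  simp only [h1]
  rw [expect_const_mul, expect_add (hterm 0) (IsBdd.sum _ fun i _ => hterm' i),
    expect_sum _ fun i _ => hterm' i, Finset.sum_congr rfl fun i _ => h2 i, ← he]
  have h3 : ∑ i : Fin m, (if c i then e else 0) = flagCount c * e := by
    rw [flagCount, Nat.cast_sum, Finset.sum_mul]
    exact Finset.sum_congr rfl fun i _ => by split_ifs <;> simp
  rw [h3]
  field_simp
  ring

theorem expect_indepLaw_cons {R : X → PMF Y} {β : PMF Bool} {ω : PMF Y} {ρ : X → PMF Y}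
    (hmix : ∀ x, R x = β.bind fun b => if b then ω else ρ x) {a : X} {l : Y → ℝ} (hl : IsBdd l)
    (hla : ∀ y, (R a y).toReal = (ω y).toReal * l y) (w : Fin m → X)
    {H : (Fin (m + 1) → Y) → ℝ} (hHb : IsBdd H)
    (hH : ∀ y (τ : Equiv.Perm (Fin (m + 1))), H (fun i => y (τ i)) = H y) :
    expect (indepLaw fun i => R ((Fin.cons a w : Fin (m + 1) → X) i)) H =
      expect (indepLaw fun _ : Fin m => β) fun c =>
        expect (flaggedLaw ω (fun i => ρ (w i)) c) fun y => flaggedAvg l c y * H y := by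
  have hb : IsBdd fun y : Fin (m + 1) → Y => l (y 0) * H y :=
    (hl.comp fun y : Fin (m + 1) → Y => y 0).mul hHb
  simp only [expect_flaggedAvg_mul ω _ _ hl hHb hH]
  have h1 : expect (indepLaw fun i => R ((Fin.cons a w : Fin (m + 1) → X) i)) H =
      expect (indepLaw (Fin.cons ω fun i => R (w i))) fun y => l (y 0) * H y := by
    rw [comp_cons, expect_indepLaw_succ _ hHb, expect_indepLaw_succ _ hb]
    simp only [Fin.cons_zero, Fin.cons_succ, expect_const_mul]
    exact expect_of_density hla _
  rw [h1, show (fun i => R (w i)) = fun i => β.bind fun b => if b then ω else ρ (w i) from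
    funext fun i => hmix (w i), indepLaw_cons_bind, expect_bind _ _ hb]
  rfl

/-! ## Independent inputs -/

/-- The constant in the bound depends only on the blanket mass of `R` and on `ε₀`. -/
theorem IsLDP.exists_mutualInfo_le [Nonempty X] {R : X → PMF Y} {ε₀ : ℝ} (hR : IsLDP R ε₀) :
    ∃ C : ℝ, ∀ (m : ℕ) (π : PMF X) (ν : PMF (Fin m → X)) (P : PMF (Fin (m + 1) → X)),
      (P = π.bind fun a => ν.map (Fin.cons a)) →
      FiniteMutualInfo (shuffleLaw R P) firstInput shuffled ∧
      |mutualInfo (shuffleLaw R P) firstInput shuffled| ≤ ε₀ ∧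
      mutualInfo (shuffleLaw R P) firstInput shuffled ≤ leakageBound ε₀ C (m + 1) := by
  obtain ⟨β, ω, ρ, hβ, hmix, hRω⟩ := hR.exists_blanket
  have hε := hR.nonneg
  set b := Real.exp ε₀ with hbdef
  set γ := (β true).toReal with hγ
  have hb1 : 1 ≤ b := Real.one_le_exp hε
  have hγ1 : γ ≤ 1 := ENNReal.toReal_le_of_le_ofReal zero_le_one (by simpa using β.coe_le_one _)
  refine ⟨(b - 1 + 6 * b ^ 4 / γ ^ 2) / 4, fun m π ν P hP => ?_⟩
  set l : X → Y → ℝ := fun a y => (R a y).toReal / (ω y).toReal with hldef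
  have hl0 : ∀ a y, 0 ≤ l a y := fun a y => div_nonneg ENNReal.toReal_nonneg ENNReal.toReal_nonneg
  have hl : ∀ a y, l a y ≤ b * γ := fun a y =>
    div_le_of_le_mul₀ ENNReal.toReal_nonneg (by positivity) (hRω a y)
  have hlb' : ∀ a y, l a y ≤ b := fun a y => (hl a y).trans (by nlinarith)
  -- Where `ω` vanishes, so does `R a`, hence the default value of `l` there is harmless.
  have hla : ∀ a y, (R a y).toReal = (ω y).toReal * l a y := fun a y => by
    rcases eq_or_ne (ω y).toReal 0 with h0 | h0
    · have := hRω a y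
      rw [h0, mul_zero] at this
      rw [h0, zero_mul]
      exact this.antisymm ENNReal.toReal_nonneg
    · simp only [hldef]
      field_simp
  have hl1 : ∀ a, expect ω (l a) = 1 := fun a => by
    have := expect_of_density (hla a) fun _ => 1
    simpa [expect_const] using this.symm
  have hlb : ∀ a, IsBdd (l a) := fun a => ⟨b, fun y => by
    rw [abs_of_nonneg (hl0 a y)]
    exact hlb' a y⟩
  have hl1b : ∀ a y, |l a y - 1| ≤ b := fun a y => by
    rw [abs_le]
    constructor <;> linarith [hl0 a y, hlb' a y]
  let E := (Fin m → Bool) × (Fin (m + 1) → Y) × Equiv.Perm (Fin (m + 1))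
  -- The reference law does not depend on `a`: the first message is drawn from `ω`. Keeping the
  -- flags in the sample space makes the averaged density a function on `E`.
  let M : PMF E := ν.bind fun w => (indepLaw fun _ : Fin m => β).bind fun c =>
    (flaggedLaw ω (fun i => ρ (w i)) c).bind fun y =>
      (PMF.uniformOfFintype (Equiv.Perm (Fin (m + 1)))).map fun σ => (c, y, σ)
  have hM : ∀ {F : E → ℝ}, IsBdd F → expect M F = expect ν fun w =>
      expect (indepLaw fun _ : Fin m => β) fun c => expect (flaggedLaw ω (fun i => ρ (w i)) c)
        fun y => expect (PMF.uniformOfFintype (Equiv.Perm (Fin (m + 1)))) fun σ => F (c, y, σ) := by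
    intro F hF
    simp only [M, expect_bind _ _ hF, expect_map _ _ hF]
  have hJ : (shuffleLaw R P).map (fun ω => (firstInput ω, shuffled ω)) =
      π.bind fun a => (ν.bind fun w => shuffledLaw R (Fin.cons a w)).map (Prod.mk a) := by
    refine (shuffleLaw_map_shuffled R P fun x => x 0).trans ?_
    rw [hP, PMF.bind_bind]
    simp only [PMF.bind_map, PMF.map_bind]
    rfl
  have hgB : ∀ (a : X) (e : E), |flaggedAvg (l a) e.1 e.2.1| ≤ b := fun a e => by
    rw [abs_of_nonneg (flaggedAvg_nonneg (hl0 a) _ _)]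
    exact flaggedAvg_le (hlb' a) _ _
  refine mutualInfo_le_of_density hJ hε (fun a a' z => ?_) M
    (fun e i => e.2.1 (e.2.2 i)) (fun a e => flaggedAvg (l a) e.1 e.2.1)
    (fun a e => flaggedAvg_nonneg (hl0 a) _ _) ⟨b, hgB⟩ (fun a h hh => ?_) fun a => ?_
  · have h := bind_apply_le_of_right ν (b := z) fun w => shuffledLaw_cons_le hR a a' w z
    rw [← ENNReal.toReal_ofReal (Real.exp_pos ε₀).le, ← ENNReal.toReal_mul]
    exact ENNReal.toReal_mono (ENNReal.mul_ne_top ENNReal.ofReal_ne_top (PMF.apply_ne_top _ _)) h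
  · rw [expect_bind _ _ hh, hM (IsBdd.mul ⟨b, hgB a⟩ (hh.comp _))]
    simp only [expect_shuffledLaw R _ hh, expect_const_mul,
      expect_indepLaw_cons hmix (hlb a) (hla a) _ hh.symmetrize (symmetrize_comp_perm h)]
    rfl
  · rw [hM (IsBdd.mul_log (fun e : E => flaggedAvg_nonneg (hl0 a) _ _) ⟨b, hgB a⟩)]
    simp only [expect_const]
    refine expect_le_of_le ?_ fun w =>
      expect_flaggedAvg_mul_log_le hβ (fun i => ρ (w i)) (hl0 a) (hl a) (hl1 a) (hl1b a)
    obtain ⟨B, hB⟩ := IsBdd.mul_log (fun e : E => flaggedAvg_nonneg (hl0 a) e.1 e.2.1) ⟨b, hgB a⟩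
    -- The density ignores the permutation, so any permutation may fill the third slot.
    exact ⟨B, fun w => abs_expect_le fun c => abs_expect_le fun y => hB (c, y, 1)⟩

/-! ## Conditioning on the other inputs -/

/-- An event decided at the first stage reweights only that stage; the normalizing masses agree
because each `κ x` has total mass 1. -/
theorem condLaw_bind {Ω α γ : Type*} (P : PMF α) (κ : α → PMF Ω) (V : Ω → γ) (v : α → γ)
    (hV : ∀ x, ∀ ω ∈ (κ x).support, V ω = v x) (c : γ) (hc : c ∈ ((P.bind κ).map V).support)
    (hc' : c ∈ (P.map v).support) :
    condLaw (P.bind κ) V c hc = (condLaw P v c hc').bind κ := by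
  classical
  have hterm : ∀ ω x, ({ω | V ω = c} : Set Ω).indicator (fun ω => P x * κ x ω) ω =
      ({x | v x = c} : Set α).indicator P x * κ x ω := fun ω x => by
    by_cases h0 : κ x ω = 0
    · simp [Set.indicator_apply, h0]
    · simp [Set.indicator_apply, hV x ω h0]
  have hind : ∀ ω, ({ω | V ω = c} : Set Ω).indicator (P.bind κ) ω =
      ∑' x, ({x | v x = c} : Set α).indicator P x * κ x ω := fun ω => by
    simp only [← hterm]
    by_cases h : V ω = c <;> simp [h, PMF.bind_apply]
  refine PMF.ext fun ω => ?_
  rw [condLaw, condLaw, PMF.filter_apply, PMF.bind_apply]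
  simp only [PMF.filter_apply, hind]
  rw [ENNReal.tsum_comm]
  simp only [ENNReal.tsum_mul_left, PMF.tsum_coe, mul_one]
  rw [← ENNReal.tsum_mul_right]
  exact tsum_congr fun x => mul_right_comm _ _ _

theorem map_congr_of_support {α β : Type*} (p : PMF α) {f g : α → β}
    (h : ∀ a ∈ p.support, f a = g a) : p.map f = p.map g := by
  classical
  refine PMF.ext fun b => ?_
  rw [PMF.map_apply, PMF.map_apply]
  refine tsum_congr fun a => ?_
  by_cases ha : p a = 0
  · simp [ha]
  · rw [h a ha]

/-- Conditioning yields another shuffle model whose other inputs are deterministic, so it falls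
under the product case with a point mass as `ν`. -/
theorem exists_condLaw_otherInputs (R : X → PMF Y) (P : PMF (Fin (m + 1) → X)) (w : Fin m → X)
    (hw : w ∈ ((shuffleLaw R P).map otherInputs).support) :
    ∃ (π : PMF X) (P' : PMF (Fin (m + 1) → X)),
      P' = (π.bind fun a => (PMF.pure w).map (Fin.cons a)) ∧
      condLaw (shuffleLaw R P) otherInputs w hw = shuffleLaw R P' := by
  have hw' : w ∈ (P.map Fin.tail).support := by
    rwa [← shuffleLaw_map_fst R P Fin.tail]
  refine ⟨(condLaw P Fin.tail w hw').map fun x => x 0, condLaw P Fin.tail w hw', ?_, ?_⟩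
  · simp only [PMF.pure_map, PMF.bind_map]
    change _ = (condLaw P Fin.tail w hw').map fun x => (Fin.cons (x 0) w : Fin (m + 1) → X)
    refine (PMF.map_id _).symm.trans (map_congr_of_support _ fun x hx => ?_)
    rw [condLaw, PMF.mem_support_filter_iff] at hx
    rw [← show Fin.tail x = w from hx.1]
    exact (Fin.cons_self_tail x).symm
  · refine condLaw_bind P _ otherInputs Fin.tail (fun x ω hω => ?_) w hw hw'
    simp only [PMF.mem_support_bind_iff, PMF.mem_support_map_iff] at hω
    obtain ⟨y, -, σ, -, rfl⟩ := hω
    rfl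

theorem eq_bind_of_independent (R : X → PMF Y) (P : PMF (Fin (m + 1) → X))
    (h : Independent (shuffleLaw R P) firstInput otherInputs) :
    P = (P.map fun x => x 0).bind fun a => (P.map Fin.tail).map (Fin.cons a) := by
  have h1 : P.map (fun x => (x 0, Fin.tail x)) =
      (P.map fun x => x 0).bind fun a => (P.map Fin.tail).map (Prod.mk a) := by
    refine PMF.ext fun ⟨a, w⟩ => ?_
    rw [bind_map_mk_apply, ← shuffleLaw_map_fst R P fun x => x 0,
      ← shuffleLaw_map_fst R P Fin.tail, ← shuffleLaw_map_fst R P fun x => (x 0, Fin.tail x)]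
    exact h a w
  have h2 := congrArg (PMF.map fun aw : X × (Fin m → X) => (Fin.cons aw.1 aw.2 : Fin (m + 1) → X))
    h1
  rw [PMF.map_comp, PMF.map_bind] at h2
  simp only [PMF.map_comp (p := P.map Fin.tail)] at h2
  refine Eq.trans ?_ h2
  rw [show ((fun aw : X × (Fin m → X) => (Fin.cons aw.1 aw.2 : Fin (m + 1) → X)) ∘
    fun x => (x 0, Fin.tail x)) = id from funext fun x => Fin.cons_self_tail x, PMF.map_id]

end Shuffle

/-- Conditional mutual information averages the mutual informations of the conditioned laws. -/
theorem condMutualInfo_le {Ω α β γ : Type*} {p : PMF Ω} {A : Ω → α} {B : Ω → β} {V : Ω → γ}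
    {ε D : ℝ} (h : ∀ c (hc : c ∈ (p.map V).support), FiniteMutualInfo (condLaw p V c hc) A B ∧
      |mutualInfo (condLaw p V c hc) A B| ≤ ε ∧ mutualInfo (condLaw p V c hc) A B ≤ D) :
    FiniteCondMutualInfo p A B V ∧ condMutualInfo p A B V ≤ D := by
  classical
  set f : γ → ℝ := fun c =>
    if hc : c ∈ (p.map V).support then mutualInfo (condLaw p V c hc) A B else 0 with hf
  have hterm : condMutualInfoTerm p A B V = fun c => (p.map V c).toReal * f c := by
    funext c
    rw [condMutualInfoTerm]
    simp only [hf]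
    split_ifs <;> simp
  -- A point of the support supplies `0 ≤ ε`, needed to bound `f` where it takes its default value
  -- 0.
  obtain ⟨c₀, hc₀⟩ := (p.map V).support_nonempty
  have hfb : IsBdd f := ⟨ε, fun c => by
    simp only [hf]
    split_ifs with hc
    · exact (h c hc).2.1
    · simpa using (abs_nonneg _).trans (h c₀ hc₀).2.1⟩
  refine ⟨⟨fun c hc => (h c hc).1, ?_⟩, ?_⟩
  · rw [hterm]
    exact summable_expect _ hfb
  · rw [condMutualInfo, hterm]
    refine (expect_mono_of_support hfb (IsBdd.const D) fun c hc => ?_).trans_eq (expect_const _ D)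
    have hc' : c ∈ (p.map V).support := hc
    simp only [hf, hc', dif_pos]
    exact (h c hc).2.2

end ShuffleDP

open ShuffleDP in
/-- The number of users is `n = m + 1`. The constant `C` depends only on the randomizer `R` (and
`ε₀`); it is uniform over the number of users, the law `P` of the database and the value of the
other inputs. -/
theorem mainTheorem1 {X Y : Type*} (R : X → PMF Y) (ε₀ : ℝ) (hR : IsLDP R ε₀) :
    ∃ C : ℝ, ∀ (m : ℕ) (P : PMF (Fin (m + 1) → X)),
      (∀ (w : Fin m → X) (hw : w ∈ ((shuffleLaw R P).map otherInputs).support),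
        FiniteMutualInfo (condLaw (shuffleLaw R P) otherInputs w hw) firstInput shuffled ∧
        mutualInfo (condLaw (shuffleLaw R P) otherInputs w hw) firstInput shuffled
          ≤ leakageBound ε₀ C (m + 1)) ∧
      (FiniteCondMutualInfo (shuffleLaw R P) firstInput shuffled otherInputs ∧
        condMutualInfo (shuffleLaw R P) firstInput shuffled otherInputs
          ≤ leakageBound ε₀ C (m + 1)) ∧
      (Independent (shuffleLaw R P) firstInput otherInputs →
        FiniteMutualInfo (shuffleLaw R P) firstInput shuffled ∧
        mutualInfo (shuffleLaw R P) firstInput shuffled ≤ leakageBound ε₀ C (m + 1)) := by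
  rcases isEmpty_or_nonempty X with hX | hX
  · refine ⟨0, fun m P => ?_⟩
    obtain ⟨x, -⟩ := P.support_nonempty
    exact isEmptyElim (x 0)
  obtain ⟨C, hC⟩ := hR.exists_mutualInfo_le
  refine ⟨C, fun m P => ?_⟩
  have hcond : ∀ w (hw : w ∈ ((shuffleLaw R P).map otherInputs).support),
      FiniteMutualInfo (condLaw (shuffleLaw R P) otherInputs w hw) firstInput shuffled ∧
      |mutualInfo (condLaw (shuffleLaw R P) otherInputs w hw) firstInput shuffled| ≤ ε₀ ∧
      mutualInfo (condLaw (shuffleLaw R P) otherInputs w hw) firstInput shuffled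
        ≤ leakageBound ε₀ C (m + 1) := fun w hw => by
    obtain ⟨π, P', hP', h⟩ := exists_condLaw_otherInputs R P w hw
    rw [h]
    exact hC m π (PMF.pure w) P' hP'
  refine ⟨fun w hw => ⟨(hcond w hw).1, (hcond w hw).2.2⟩, condMutualInfo_le hcond, fun hind => ?_⟩
  have h := hC m _ _ P (eq_bind_of_independent R P hind)
  exact ⟨h.1, h.2.2⟩
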